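/- Let $\{S[t]\}_{t\ge 1}$ be a discrete memoryless source: the $S[t]$ are i.i.d. with a common law (the law of $S$) on a finite alphabet $\mathcal S$; let $H(\cdot)$ be Shannon entropy, and let all logarithms, in the entropies and in the rates, be natural. Let $L,N,m$ be integers with $0\le N<m\le L$, and $\Omega_L=\{1,\dots,L\}$. An $(n,(M_1,\dots,M_L))$ code consists of a random key $K$ in an arbitrary key space $\mathcal K$, independent of the source block $S^n=(S[1],\dots,S[n])$, of encoding functions $e_l:\mathcal S^n\times\mathcal K\to\{1,\dots,M_l\}$, $l\in\Omega_L$, with outputs $X_l=e_l(S^n,K)$, and of decoding functions $d_U:\prod_{l\in U}\{1,\dots,M_l\}\to\mathcal S^n$ for all $U\subseteq\Omega_L$ with $|U|\ge m$. For $U\subseteq\Omega_L$ write $X_U=\{X_l:l\in U\}$. In the $(L,N,m)$ secure symmetrical single-level diversity coding (S-SSDC) problem, a rate tuple $(R_1,\dots,R_L)$ of nonnegative reals is called admissible if for every $\epsilon>0$ there exists, for all sufficiently large $n$, an $(n,(M_1,\dots,M_L))$ code such that (i) $\frac1n\log M_l\le R_l+\epsilon$ for all $l\in\Omega_L$; (ii)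 $\Pr\{d_U(X_U)\ne S^n\}\le\epsilon$ for all $U\subseteq\Omega_L$ with $|U|\ge m$; (iii) $H(S^n\mid X_A)=H(S^n)$ for all $A\subseteq\Omega_L$ with $|A|\le N$. Let $\mathcal R$ be the set of all admissible rate tuples. Then the minimum sum rate $\min_{(R_1,\dots,R_L)\in\mathcal R}\sum_{l=1}^L R_l$ exists (the minimum is attained), and $$\min_{(R_1,\dots,R_L)\in\mathcal R}\ \sum_{l=1}^L R_l=\frac{L}{m-N}\,H(S).$$ -/

import Mathlib

open MeasureTheory ProbabilityTheory Filter

noncomputable section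

/-- Shannon entropy `H(X) = -∑ₓ Pr{X = x} log Pr{X = x}` (natural logarithm) of a random variable
`X` with values in a finite set. -/
def shannonEntropy {Ω β : Type*} [MeasurableSpace Ω] [Fintype β] (μ : Measure Ω) (X : Ω → β) : ℝ :=
  ∑ x : β, Real.negMulLog (μ.real (X ⁻¹' {x}))

/-- Conditional Shannon entropy `H(X | Y) = ∑_y Pr{Y = y} H(X | Y = y)` of random variables with
values in finite sets. -/
def condShannonEntropy {Ω β γ : Type*} [MeasurableSpace Ω] [Fintype β] [Fintype γ]
    (μ : Measure Ω) (X : Ω → β) (Y : Ω → γ) : ℝ :=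
  ∑ y : γ, μ.real (Y ⁻¹' {y}) * shannonEntropy (cond μ (Y ⁻¹' {y})) X

/-- An `(n, (M₁, …, M_L))` code for source alphabet `α`, whose decoders are indexed by the sets of
at least `m` encoders. The key space is an arbitrary probability space. -/
structure SSDCCode (α : Type*) [MeasurableSpace α] (L m n : ℕ) (M : Fin L → ℕ) where
  /-- the key space -/
  Key : Type
  /-- the measurable structure of the key space -/
  keySpace : MeasurableSpace Key
  /-- the law of the key -/
  keyLaw : Measure Key
  /-- the law of the key is a probability measure -/
  isProb : IsProbabilityMeasure keyLaw
  /-- the encoding functions -/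
  enc : (l : Fin L) → (Fin n → α) × Key → Fin (M l)
  /-- the encoder outputs are random variables -/
  measurable_enc : ∀ l, Measurable (enc l)
  /-- the decoding functions -/
  dec : (U : Finset (Fin L)) → m ≤ U.card → ((l : U) → Fin (M l)) → (Fin n → α)

attribute [instance] SSDCCode.keySpace SSDCCode.isProb

namespace SSDCCode

variable {α : Type*} [MeasurableSpace α] {L m n : ℕ} {M : Fin L → ℕ}

/-- The joint law of `(Sⁿ, K)`: the source letters are i.i.d. with law `P`, and the key is
independent of the source. -/
def law (c : SSDCCode α L m n M) (P : Measure α) : Measure ((Fin n → α) × c.Key) :=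
  (Measure.pi fun _ : Fin n => P).prod c.keyLaw

/-- The source block `Sⁿ` as a random variable. -/
def source (c : SSDCCode α L m n M) : (Fin n → α) × c.Key → (Fin n → α) :=
  Prod.fst

/-- The encoder outputs `X_U = {X_l : l ∈ U}`, where `X_l = e_l(Sⁿ, K)`. -/
def output (c : SSDCCode α L m n M) (U : Finset (Fin L)) (ω : (Fin n → α) × c.Key) :
    (l : U) → Fin (M l) :=
  fun l => c.enc l ω

end SSDCCode

/-- A nonnegative rate tuple `R` is admissible for the `(L, N, m)` secure symmetrical single-level
diversity coding problem with source law `P`. -/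
def SSDCAdmissible {α : Type*} [Fintype α] [MeasurableSpace α] (P : Measure α) (L N m : ℕ)
    (R : Fin L → ℝ) : Prop :=
  (∀ l, 0 ≤ R l) ∧
  ∀ ε : ℝ, 0 < ε → ∀ᶠ n : ℕ in atTop, ∃ (M : Fin L → ℕ) (c : SSDCCode α L m n M),
    -- rate constraints
    (∀ l, (1 / (n : ℝ)) * Real.log (M l) ≤ R l + ε) ∧
    -- asymptotically perfect reconstruction at the legitimate receiver
    (∀ (U : Finset (Fin L)) (hU : m ≤ U.card),
      (c.law P).real {ω | c.dec U hU (c.output U ω) ≠ c.source ω} ≤ ε) ∧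
    -- perfect secrecy at the eavesdropper
    (∀ A : Finset (Fin L), A.card ≤ N →
      condShannonEntropy (c.law P) c.source (c.output A) = shannonEntropy (c.law P) c.source)

/-- The admissible rate region. -/
def ssdcRegion {α : Type*} [Fintype α] [MeasurableSpace α] (P : Measure α) (L N m : ℕ) :
    Set (Fin L → ℝ) :=
  {R | SSDCAdmissible P L N m R}

end

/-! Converse: split `m` encoders into a set `A` of size `N` and a set `B` of size `m - N`. By
secrecy `X_A` is independent of the source block, so once `X_A = a` is fixed, the decoder can only
output blocks from a set of at most `∏ l ∈ B, M l` elements, whose probability is still computed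
under the product law (`SSDCCode.one_sub_le_of_secrecy`). By equipartition a set of non-negligible
mass needs about `exp (n H)` blocks, hence the rates in `B` add up to at least `H`. Averaging over
the cyclic shifts of one `B` gives `L / (m - N) * H`. Counting replaces Fano's inequality here.

Achievability: with `k = m - N`, encode the typical blocks injectively as `k` symbols of a prime
field with about `exp (n H / k)` elements, and use them as the top coefficients of a polynomial
whose `N` low coefficients are a uniform key. Each encoder sends one value of the polynomial. Any `N
+ k` values determine it (`eq_of_eval_sharePoly_eq`), while any `N` are distributed independently of
the message (`exists_eval_sharePoly_add_eq`). So every rate equal to `H / k` is admissible, which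
attains the bound. -/

noncomputable section

/-! ### Perfect secrecy as independence -/

section Secrecy

variable {Ω β γ : Type*} [MeasurableSpace Ω] [Fintype β] [Fintype γ] {μ : Measure Ω}
  [IsProbabilityMeasure μ] {X : Ω → β} {Y : Ω → γ}

lemma sum_measureReal_inter_fiber (hY : ∀ y, MeasurableSet (Y ⁻¹' {y}))
    {s : Set Ω} (hs : MeasurableSet s) :
    ∑ y, μ.real (Y ⁻¹' {y} ∩ s) = μ.real s := by
  rw [← measureReal_biUnion_finset (s := Finset.univ)]
  · congr 1
    ext ω
    simp
  · intro y _ y' _ hne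
    refine Set.disjoint_left.2 fun ω h h' => hne ?_
    exact h.1.symm.trans h'.1
  · exact fun y _ => (hY y).inter hs

lemma measureReal_mul_cond_real {s : Set Ω} (hs : MeasurableSet s) (t : Set Ω) :
    μ.real s * (cond μ s).real t = μ.real (s ∩ t) := by
  rw [mul_comm, measureReal_def, measureReal_def, measureReal_def, ← ENNReal.toReal_mul,
    cond_mul_eq_inter hs]

lemma sum_measureReal_fiber (hY : ∀ y, MeasurableSet (Y ⁻¹' {y})) :
    ∑ y, μ.real (Y ⁻¹' {y}) = 1 := by
  simpa using sum_measureReal_inter_fiber (μ := μ) hY .univ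

/-- If conditioning on `Y` does not decrease the entropy of `X`, then `X` and `Y` are
independent. -/
lemma measureReal_inter_eq_mul_of_condShannonEntropy_eq
    (hX : ∀ x, MeasurableSet (X ⁻¹' {x})) (hY : ∀ y, MeasurableSet (Y ⁻¹' {y}))
    (h : condShannonEntropy μ X Y = shannonEntropy μ X) (x : β) (y : γ) :
    μ.real (Y ⁻¹' {y} ∩ X ⁻¹' {x}) = μ.real (Y ⁻¹' {y}) * μ.real (X ⁻¹' {x}) := by
  have mean (x : β) :
      ∑ y, μ.real (Y ⁻¹' {y}) • (cond μ (Y ⁻¹' {y})).real (X ⁻¹' {x}) = μ.real (X ⁻¹' {x}) := by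
    rw [← sum_measureReal_inter_fiber hY (hX x)]
    refine Finset.sum_congr rfl fun y _ => ?_
    rw [smul_eq_mul, measureReal_mul_cond_real (hY y)]
  have mem (x : β) : ∀ y ∈ (Finset.univ : Finset γ),
      (cond μ (Y ⁻¹' {y})).real (X ⁻¹' {x}) ∈ Set.Ici (0 : ℝ) := fun y _ => measureReal_nonneg
  have nn : ∀ y ∈ (Finset.univ : Finset γ), 0 ≤ μ.real (Y ⁻¹' {y}) :=
    fun y _ => measureReal_nonneg
  have jensen (x : β) := Real.concaveOn_negMulLog.le_map_sum nn (sum_measureReal_fiber hY) (mem x)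
  have heq : ∑ x, ∑ y, μ.real (Y ⁻¹' {y}) •
      Real.negMulLog ((cond μ (Y ⁻¹' {y})).real (X ⁻¹' {x}))
      = ∑ x, Real.negMulLog (∑ y, μ.real (Y ⁻¹' {y}) •
        (cond μ (Y ⁻¹' {y})).real (X ⁻¹' {x})) := by
    simp only [mean]
    rw [Finset.sum_comm]
    simpa [condShannonEntropy, shannonEntropy, Finset.mul_sum] using h
  -- Jensen inequalities that add up to an equality are all equalities; strict concavity then makes
  -- the conditional probability constant over the `y` of positive weight.
  have heq' := (Finset.sum_eq_sum_iff_of_le fun x _ => jensen x).1 heq x (Finset.mem_univ x)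
  have key := (Real.strictConcaveOn_negMulLog.map_sum_eq_iff' nn (sum_measureReal_fiber hY)
    (mem x)).1 heq'.symm y (Finset.mem_univ y)
  rw [mean] at key
  by_cases h0 : μ.real (Y ⁻¹' {y}) = 0
  · rw [h0, zero_mul]
    exact le_antisymm (h0 ▸ measureReal_mono Set.inter_subset_left) measureReal_nonneg
  · rw [← key h0, measureReal_mul_cond_real (hY y)]

lemma condShannonEntropy_eq_of_measureReal_inter_eq_mul (hY : ∀ y, MeasurableSet (Y ⁻¹' {y}))
    (h : ∀ x y, μ.real (Y ⁻¹' {y} ∩ X ⁻¹' {x}) = μ.real (Y ⁻¹' {y}) * μ.real (X ⁻¹' {x})) :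
    condShannonEntropy μ X Y = shannonEntropy μ X := by
  rw [← one_mul (shannonEntropy μ X), ← sum_measureReal_fiber (μ := μ) hY, Finset.sum_mul]
  refine Finset.sum_congr rfl fun y _ => ?_
  by_cases h0 : μ.real (Y ⁻¹' {y}) = 0
  · simp [h0]
  · congr 1
    refine Finset.sum_congr rfl fun x _ => ?_
    refine congrArg _ (mul_left_cancel₀ h0 ?_)
    rw [measureReal_mul_cond_real (hY y), h]

end Secrecy

/-! ### Weak typicality and equipartition -/

section Typical

variable {α : Type*} [Fintype α] [MeasurableSpace α] [MeasurableSingletonClass α]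
  (P : Measure α) [IsProbabilityMeasure P]

/-- The information content of a source letter. -/
def selfInfo (s : α) : ℝ := -Real.log (P.real {s})

/-- The weakly typical blocks: those of positive probability whose empirical information content is
`δ`-close to the entropy. -/
def typicalSet (n : ℕ) (δ : ℝ) : Set (Fin n → α) :=
  {s | (∀ i, P.real {s i} ≠ 0) ∧
    |∑ i, selfInfo P (s i) - n * shannonEntropy P (fun s : α => s)| < n * δ}

lemma integral_selfInfo : ∫ s, selfInfo P s ∂P = shannonEntropy P (fun s : α => s) := by
  rw [integral_fintype .of_finite]
  refine Finset.sum_congr rfl fun s _ => ?_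
  simp [selfInfo, Real.negMulLog]

omit [MeasurableSingletonClass α] in
lemma measureReal_pi_singleton {n : ℕ} {δ : ℝ} {s : Fin n → α} (hs : s ∈ typicalSet P n δ) :
    (Measure.pi fun _ : Fin n => P).real {s} = Real.exp (-∑ i, selfInfo P (s i)) := by
  have h : ∀ i, 0 < P.real {s i} := fun i => lt_of_le_of_ne measureReal_nonneg (hs.1 i).symm
  rw [measureReal_def, Measure.pi_singleton, ENNReal.toReal_prod, ← Finset.sum_neg_distrib,
    Real.exp_sum]
  refine Finset.prod_congr rfl fun i _ => ?_
  rw [selfInfo, neg_neg, Real.exp_log (h i), measureReal_def]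

/-- Each typical block has mass at least `exp (-(n * (H + δ)))`, and the total mass is at most 1. -/
lemma card_typicalSet_le (n : ℕ) (δ : ℝ) :
    ((typicalSet P n δ).ncard : ℝ) ≤
      Real.exp (n * (shannonEntropy P (fun s : α => s) + δ)) := by
  classical
  set T := (Set.toFinite (typicalSet P n δ)).toFinset with hT
  set H := shannonEntropy P (fun s : α => s)
  have h1 : ∑ s ∈ T, (Measure.pi fun _ : Fin n => P).real {s} ≤ 1 := by
    rw [sum_measureReal_singleton]
    exact measureReal_le_one
  have h2 : (T.card : ℝ) * Real.exp (-(n * (H + δ))) ≤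
      ∑ s ∈ T, (Measure.pi fun _ : Fin n => P).real {s} := by
    rw [← nsmul_eq_mul]
    refine Finset.card_nsmul_le_sum _ _ _ fun s hs => ?_
    have hs' : s ∈ typicalSet P n δ := by simpa [hT] using hs
    rw [measureReal_pi_singleton P hs']
    have := (abs_lt.1 hs'.2).2
    exact Real.exp_le_exp.2 (by linarith)
  rw [Set.ncard_eq_toFinset_card _ (Set.toFinite _), ← hT]
  have h3 := h2.trans h1
  rwa [Real.exp_neg, ← div_eq_mul_inv, div_le_one (Real.exp_pos _)] at h3

/-- A set of blocks has at most the mass of the atypical blocks plus its size times the largest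
probability of a typical block. -/
lemma measureReal_pi_le_of_card (n : ℕ) (δ : ℝ) (D : Set (Fin n → α)) :
    (Measure.pi fun _ : Fin n => P).real D ≤
      (Measure.pi fun _ : Fin n => P).real (typicalSet P n δ)ᶜ +
        D.ncard * Real.exp (-(n * (shannonEntropy P (fun s : α => s) - δ))) := by
  classical
  set T := (Set.toFinite (D ∩ typicalSet P n δ)).toFinset with hT
  set H := shannonEntropy P (fun s : α => s)
  have h1 : (Measure.pi fun _ : Fin n => P).real (D ∩ typicalSet P n δ) ≤
      D.ncard * Real.exp (-(n * (H - δ))) := by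
    have : (T : Set (Fin n → α)) = D ∩ typicalSet P n δ := by simp [hT]
    rw [← this, ← sum_measureReal_singleton]
    have hc : (T.card : ℝ) ≤ D.ncard := by
      rw [← Set.ncard_coe_finset, this]
      exact_mod_cast Set.ncard_le_ncard Set.inter_subset_left (Set.toFinite _)
    refine le_trans ?_ (mul_le_mul_of_nonneg_right hc (Real.exp_pos _).le)
    rw [← nsmul_eq_mul]
    refine Finset.sum_le_card_nsmul _ _ _ fun s hs => ?_
    have hs' : s ∈ typicalSet P n δ := by
      have : s ∈ D ∩ typicalSet P n δ := by simpa [hT] using hs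
      exact this.2
    rw [measureReal_pi_singleton P hs']
    have := (abs_lt.1 hs'.2).1
    exact Real.exp_le_exp.2 (by linarith)
  calc (Measure.pi fun _ : Fin n => P).real D
      ≤ (Measure.pi fun _ : Fin n => P).real ((typicalSet P n δ)ᶜ ∪ (D ∩ typicalSet P n δ)) := by
        refine measureReal_mono fun s hs => ?_
        by_cases h : s ∈ typicalSet P n δ
        · exact Or.inr ⟨hs, h⟩
        · exact Or.inl h
    _ ≤ _ := measureReal_union_le _ _
    _ ≤ _ := by gcongr

/-- Chebyshev's inequality for the sum of the i.i.d. self-informations, whose common mean is the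
entropy. -/
lemma measureReal_compl_typicalSet_le {n : ℕ} (hn : 0 < n) {δ : ℝ} (hδ : 0 < δ) :
    (Measure.pi fun _ : Fin n => P).real (typicalSet P n δ)ᶜ ≤
      variance (selfInfo P) P / (n * δ ^ 2) := by
  set H := shannonEntropy P (fun s : α => s) with hH
  set μ := Measure.pi fun _ : Fin n => P with hμ
  set Z : (Fin n → α) → ℝ := ∑ i, fun s => selfInfo P (s i) with hZ
  have hn' : (0 : ℝ) < n := by exact_mod_cast hn
  have hvar : variance Z μ = n * variance (selfInfo P) P := by
    rw [hZ, hμ, variance_sum_pi (X := fun _ => selfInfo P) fun i => .of_discrete]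
    simp
  have hmean : ∫ s, Z s ∂μ = n * H := by
    simp only [hZ, Finset.sum_apply]
    rw [integral_finsetSum _ fun i _ => .of_finite]
    have (i : Fin n) : ∫ s, selfInfo P (s i) ∂μ = H := by
      rw [hμ, integral_comp_eval (μ := fun _ : Fin n => P) (f := selfInfo P)
        (Measurable.of_discrete).aestronglyMeasurable, integral_selfInfo]
    simp [this]
  have cheb := meas_ge_le_variance_div_sq (μ := μ) (X := Z) .of_discrete
    (c := n * δ) (by positivity)
  rw [hmean, hvar] at cheb
  -- On letters of probability zero `selfInfo` takes the default value 0; blocks containing them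
  -- form a null set.
  have hnull : μ.real {s | ∃ i, P.real {s i} = 0} = 0 := by
    have hsub : {s : Fin n → α | ∃ i, P.real {s i} = 0} =
        ((Set.toFinite {s : Fin n → α | ∃ i, P.real {s i} = 0}).toFinset : Set _) := by simp
    rw [hsub, ← sum_measureReal_singleton]
    refine Finset.sum_eq_zero fun s hs => ?_
    obtain ⟨i, hi⟩ : ∃ i, P.real {s i} = 0 := by simpa using hs
    rw [measureReal_def, hμ, Measure.pi_singleton, ENNReal.toReal_prod]
    exact Finset.prod_eq_zero (Finset.mem_univ i) hi
  have hcover : (typicalSet P n δ)ᶜ ⊆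
      {s | ∃ i, P.real {s i} = 0} ∪ {s | n * δ ≤ |Z s - n * H|} := by
    intro s hs
    by_cases h : ∃ i, P.real {s i} = 0
    · exact Or.inl h
    · push Not at h
      refine Or.inr ?_
      by_contra h'
      exact hs ⟨h, by simpa [hZ] using h'⟩
  calc μ.real (typicalSet P n δ)ᶜ
      ≤ μ.real ({s | ∃ i, P.real {s i} = 0} ∪ {s | n * δ ≤ |Z s - n * H|}) :=
        measureReal_mono hcover
    _ ≤ μ.real {s | ∃ i, P.real {s i} = 0} + μ.real {s | n * δ ≤ |Z s - n * H|} :=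
        measureReal_union_le _ _
    _ = μ.real {s | n * δ ≤ |Z s - n * H|} := by rw [hnull, zero_add]
    _ ≤ n * variance (selfInfo P) P / (n * δ) ^ 2 :=
        ENNReal.toReal_le_of_le_ofReal
          (div_nonneg (mul_nonneg hn'.le (variance_nonneg _ _)) (sq_nonneg _)) cheb
    _ = variance (selfInfo P) P / (n * δ ^ 2) := by field_simp

/-- The asymptotic equipartition property. -/
lemma eventually_measureReal_compl_typicalSet_le {δ : ℝ} (hδ : 0 < δ) {ε : ℝ} (hε : 0 < ε) :
    ∀ᶠ n : ℕ in atTop, (Measure.pi fun _ : Fin n => P).real (typicalSet P n δ)ᶜ ≤ ε := by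
  have hlim : Tendsto (fun n : ℕ => variance (selfInfo P) P / (n * δ ^ 2)) atTop (nhds 0) := by
    refine Tendsto.const_div_atTop ?_ _
    exact tendsto_natCast_atTop_atTop.atTop_mul_const (by positivity)
  filter_upwards [hlim.eventually_le_const hε, eventually_gt_atTop 0] with n h hn
  exact (measureReal_compl_typicalSet_le P hn hδ).trans h

end Typical

/-! ### Converse: lower bound on the sum rate -/

section Converse

namespace SSDCCode

variable {α : Type*} [MeasurableSpace α] {L m n : ℕ} {M : Fin L → ℕ}
  (c : SSDCCode α L m n M) (P : Measure α) [IsProbabilityMeasure P]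

instance isProbabilityMeasure_law : IsProbabilityMeasure (c.law P) := by
  unfold law
  infer_instance

omit [IsProbabilityMeasure P] in
lemma measureReal_source_preimage {D : Set (Fin n → α)} (hD : MeasurableSet D) :
    (c.law P).real (c.source ⁻¹' D) = (Measure.pi fun _ : Fin n => P).real D :=
  measurePreserving_fst.measureReal_preimage hD.nullMeasurableSet

lemma measurable_output (U : Finset (Fin L)) : Measurable (c.output U) :=
  measurable_pi_lambda _ fun l => c.measurable_enc l

/-- Joins outputs indexed by `A` with outputs indexed by `B`. -/
def glue (M : Fin L → ℕ) (A B : Finset (Fin L)) (a : (l : A) → Fin (M l)) (b : (l : B) → Fin (M l))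
    (l : (A ∪ B : Finset (Fin L))) : Fin (M l) :=
  if h : l.1 ∈ A then a ⟨l.1, h⟩ else b ⟨l.1, (Finset.mem_union.1 l.2).resolve_left h⟩

lemma glue_output (A B : Finset (Fin L)) (ω : (Fin n → α) × c.Key) :
    glue M A B (c.output A ω) (c.output B ω) = c.output (A ∪ B) ω := by
  funext l
  unfold glue output
  split <;> rfl

/-- If the outputs in `A` are independent of the source, then a decoder that sees the outputs in
`A ∪ B` succeeds with at most the largest probability of a set of `∏ l ∈ B, M l` blocks. -/
lemma one_sub_le_of_secrecy [Fintype α] [MeasurableSingletonClass α]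
    {A B : Finset (Fin L)} (hU : m ≤ (A ∪ B).card)
    (hsec : condShannonEntropy (c.law P) c.source (c.output A) = shannonEntropy (c.law P) c.source)
    {ε : ℝ} (herr : (c.law P).real
      {ω | c.dec (A ∪ B) hU (c.output (A ∪ B) ω) ≠ c.source ω} ≤ ε)
    {b : ℝ} (hb : ∀ D : Set (Fin n → α), D.ncard ≤ ∏ l ∈ B, M l →
      (Measure.pi fun _ : Fin n => P).real D ≤ b) :
    1 - ε ≤ b := by
  classical
  have hX : ∀ s, MeasurableSet (c.source ⁻¹' {s}) := fun s =>
    measurable_fst (measurableSet_singleton s)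
  have hY : ∀ a, MeasurableSet (c.output A ⁻¹' {a}) := fun a =>
    c.measurable_output A (measurableSet_singleton a)
  -- All blocks the decoder can return when the outputs in `A` equal `a`.
  let D (a : (l : A) → Fin (M l)) : Set (Fin n → α) :=
    Set.range fun v : (l : B) → Fin (M l) => c.dec (A ∪ B) hU (glue M A B a v)
  have hD (a) : (D a).ncard ≤ ∏ l ∈ B, M l := by
    have h1 : (D a).ncard ≤ Nat.card ((l : B) → Fin (M l)) := by
      rw [← Nat.card_coe_set_eq]
      exact Finite.card_range_le _
    refine h1.trans_eq ?_
    rw [Nat.card_eq_fintype_card, Fintype.card_pi, ← Finset.prod_coe_sort B M]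
    simp
  have hind (a) : (c.law P).real (c.output A ⁻¹' {a} ∩ c.source ⁻¹' D a) =
      (c.law P).real (c.output A ⁻¹' {a}) * (Measure.pi fun _ : Fin n => P).real (D a) := by
    obtain ⟨T, hT⟩ := (Set.toFinite (D a)).exists_finset_coe
    have hun : c.output A ⁻¹' {a} ∩ c.source ⁻¹' D a =
        ⋃ s ∈ T, c.output A ⁻¹' {a} ∩ c.source ⁻¹' {s} := by
      ext ω
      simp [← hT]
    rw [hun, measureReal_biUnion_finset, ← hT, ← sum_measureReal_singleton, Finset.mul_sum]
    · refine Finset.sum_congr rfl fun s _ => ?_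
      rw [measureReal_inter_eq_mul_of_condShannonEntropy_eq hX hY hsec,
        c.measureReal_source_preimage P (measurableSet_singleton s)]
    · intro s _ s' _ hne
      exact Set.disjoint_left.2 fun ω h h' => hne (h.2.symm.trans h'.2)
    · exact fun s _ => (hY a).inter (hX s)
  set E := {ω | c.dec (A ∪ B) hU (c.output (A ∪ B) ω) ≠ c.source ω} with hE
  have hcover : (Set.univ : Set ((Fin n → α) × c.Key)) ⊆
      E ∪ ⋃ a ∈ (Finset.univ : Finset ((l : A) → Fin (M l))),
        c.output A ⁻¹' {a} ∩ c.source ⁻¹' D a := by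
    intro ω _
    by_cases h : ω ∈ E
    · exact Or.inl h
    · refine Or.inr (Set.mem_biUnion (x := c.output A ω) (by simp) ⟨rfl, c.output B ω, ?_⟩)
      have h' : c.dec (A ∪ B) hU (c.output (A ∪ B) ω) = c.source ω := not_not.1 h
      simpa only [glue_output] using h'
  have h1 : 1 ≤ ε + b := by
    calc (1 : ℝ) = (c.law P).real Set.univ := by simp
      _ ≤ _ := measureReal_mono hcover
      _ ≤ _ := measureReal_union_le _ _
      _ ≤ ε + ∑ a, (c.law P).real (c.output A ⁻¹' {a} ∩ c.source ⁻¹' D a) :=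
          add_le_add herr (measureReal_biUnion_finset_le _ _)
      _ ≤ ε + ∑ a, (c.law P).real (c.output A ⁻¹' {a}) * b := by
          gcongr with a
          rw [hind]
          exact mul_le_mul_of_nonneg_left (hb _ (hD a)) measureReal_nonneg
      _ = ε + b := by rw [← Finset.sum_mul, sum_measureReal_fiber hY, one_mul]
  linarith

end SSDCCode

variable {α : Type*} [Fintype α] [MeasurableSpace α] [MeasurableSingletonClass α]
  {P : Measure α} [IsProbabilityMeasure P] {L N m : ℕ} {R : Fin L → ℝ}

/-- In an admissible tuple, the rates of any `m - N` encoders add up to at least the entropy. -/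
lemma SSDCAdmissible.shannonEntropy_le_sum (hR : SSDCAdmissible P L N m R) (hNm : N < m)
    (hmL : m ≤ L) {B : Finset (Fin L)} (hB : B.card = m - N) :
    shannonEntropy P (fun s : α => s) ≤ ∑ l ∈ B, R l := by
  set H := shannonEntropy P (fun s : α => s) with hH
  obtain ⟨A, hAB, hA⟩ : ∃ A ⊆ Bᶜ, A.card = N := by
    refine Finset.exists_subset_card_eq ?_
    rw [Finset.card_compl, Fintype.card_fin]
    omega
  have hU : m ≤ (A ∪ B).card := by
    rw [Finset.card_union_of_disjoint]
    · omega
    · exact Finset.disjoint_left.2 fun l hl => Finset.mem_compl.1 (hAB hl)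
  by_contra! hlt
  -- Of the gap `3 * η`, one part absorbs the rate slack `B.card * ε`, one the typicality tolerance,
  -- and the last gives the decay `exp (-(n * η))`.
  obtain ⟨η, hη, hgap⟩ : ∃ η > 0, ∑ l ∈ B, R l + 3 * η = H :=
    ⟨(H - ∑ l ∈ B, R l) / 3, by linarith, by ring⟩
  obtain ⟨ε, hε, hε4, hεB⟩ : ∃ ε > 0, ε ≤ 1 / 4 ∧ B.card * ε ≤ η := by
    refine ⟨min (1 / 4) (η / (B.card + 1)), by positivity, min_le_left _ _, ?_⟩
    calc (B.card : ℝ) * min (1 / 4) (η / (B.card + 1)) ≤ (B.card + 1) * (η / (B.card + 1)) := by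
          gcongr
          · linarith
          · exact min_le_right _ _
      _ = η := by field_simp
  have hexp : Tendsto (fun n : ℕ => Real.exp (-(n * η))) atTop (nhds 0) :=
    Real.tendsto_exp_neg_atTop_nhds_zero.comp (tendsto_natCast_atTop_atTop.atTop_mul_const hη)
  obtain ⟨n, ⟨M, c, hrate, herr, hsec⟩, htyp, hsmall, hn⟩ :=
    ((hR.2 ε hε).and ((eventually_measureReal_compl_typicalSet_le P hη
      (by norm_num : (0 : ℝ) < 1 / 4)).and ((hexp.eventually_le_const
        (by norm_num : (0 : ℝ) < 1 / 4)).and (eventually_gt_atTop 0)))).exists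
  have hn' : (0 : ℝ) < n := by exact_mod_cast hn
  have hprod : ((∏ l ∈ B, M l : ℕ) : ℝ) ≤ Real.exp (n * (H - 2 * η)) := by
    calc ((∏ l ∈ B, M l : ℕ) : ℝ) = ∏ l ∈ B, (M l : ℝ) := by push_cast; rfl
      _ ≤ ∏ l ∈ B, Real.exp (n * (R l + ε)) := by
          refine Finset.prod_le_prod (fun l _ => by positivity) fun l _ => ?_
          have h := hrate l
          rw [one_div, inv_mul_le_iff₀ hn'] at h
          exact (Real.le_exp_log _).trans (Real.exp_le_exp.2 h)
      _ = Real.exp (n * (∑ l ∈ B, R l + B.card * ε)) := by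
          rw [← Real.exp_sum, ← Finset.mul_sum, Finset.sum_add_distrib]
          simp
      _ ≤ _ := by
          refine Real.exp_le_exp.2 (mul_le_mul_of_nonneg_left ?_ hn'.le)
          linarith
  -- Contradiction: `1 - ε` is at least `3 / 4`, but the bound is `1 / 2`.
  have key := c.one_sub_le_of_secrecy P hU (hsec A hA.le) (herr _ hU) (b := 1 / 4 + 1 / 4)
    fun D hD => by
      refine (measureReal_pi_le_of_card P n η D).trans (add_le_add htyp ?_)
      calc (D.ncard : ℝ) * Real.exp (-(n * (H - η)))
          ≤ Real.exp (n * (H - 2 * η)) * Real.exp (-(n * (H - η))) := by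
            gcongr
            exact le_trans (by exact_mod_cast hD) hprod
        _ = Real.exp (-(n * η)) := by rw [← Real.exp_add]; ring_nf
        _ ≤ _ := hsmall
  linarith

/-- If any `k` of `L ≥ k` numbers add up to at least `H`, then all of them add up to at least
`L / k * H`. -/
lemma div_mul_le_sum_of_forall_card {k : ℕ} (hk : 0 < k) (hkL : k ≤ L) {H : ℝ}
    (h : ∀ B : Finset (Fin L), B.card = k → H ≤ ∑ l ∈ B, R l) :
    (L : ℝ) / k * H ≤ ∑ l, R l := by
  have : NeZero L := ⟨by omega⟩
  let f (j : Fin k) : Fin L := Fin.castLE hkL j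
  have hf : Function.Injective f := Fin.castLE_injective hkL
  -- Cyclic shifts of the first `k` indices: over all `L` shifts each index is covered `k` times.
  have h1 (i : Fin L) : H ≤ ∑ j, R (f j + i) := by
    have := h (Finset.univ.map ⟨fun j => f j + i, fun j j' e => hf (add_right_cancel e)⟩)
      (by simp)
    rwa [Finset.sum_map] at this
  have h2 : (L : ℝ) * H ≤ k * ∑ l, R l := by
    calc (L : ℝ) * H = ∑ _i : Fin L, H := by simp
      _ ≤ ∑ i : Fin L, ∑ j, R (f j + i) := Finset.sum_le_sum fun i _ => h1 i
      _ = ∑ j : Fin k, ∑ i, R (f j + i) := Finset.sum_comm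
      _ = ∑ _j : Fin k, ∑ l, R l :=
          Finset.sum_congr rfl fun j _ => Equiv.sum_comp (Equiv.addLeft (f j)) R
      _ = _ := by simp
  have hk' : (0 : ℝ) < k := by exact_mod_cast hk
  rw [div_mul_eq_mul_div, div_le_iff₀ hk']
  linarith

end Converse

/-! ### Polynomial secret sharing -/

section SecretSharing

open Polynomial

variable {F : Type*} [Field F] {N k : ℕ}

/-- The sharing polynomial `K₀ + K₁ X + ⋯ + X ^ N * (w₀ + w₁ X + ⋯)` of a key `K` and a
message `w`. -/
def sharePoly (w : Fin k → F) (K : Fin N → F) : F[X] :=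
  ((degreeLTEquiv F N).symm K : F[X]) + X ^ N * ((degreeLTEquiv F k).symm w : F[X])

lemma sharePoly_sub (w w' : Fin k → F) (K K' : Fin N → F) :
    sharePoly w K - sharePoly w' K' = sharePoly (w - w') (K - K') := by
  simp only [sharePoly, map_sub, Submodule.coe_sub]
  ring

lemma degree_sharePoly_lt (w : Fin k → F) (K : Fin N → F) :
    (sharePoly w K).degree < (N + k : ℕ) := by
  have h1 := mem_degreeLT.1 ((degreeLTEquiv F N).symm K).2
  have h2 := mem_degreeLT.1 ((degreeLTEquiv F k).symm w).2
  refine (degree_add_le _ _).trans_lt (max_lt ?_ ?_)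
  · exact h1.trans_le (by exact_mod_cast Nat.le_add_right N k)
  · rw [degree_mul, degree_X_pow, Nat.cast_add]
    exact WithBot.add_lt_add_left (by simp) h2

/-- The key part has degree below `N` and the message part is a multiple of `X ^ N`, so they cannot
cancel. -/
lemma eq_zero_of_sharePoly_eq_zero {w : Fin k → F} {K : Fin N → F} (h : sharePoly w K = 0) :
    w = 0 := by
  have h1 := mem_degreeLT.1 ((degreeLTEquiv F N).symm K).2
  rw [sharePoly, add_eq_zero_iff_eq_neg] at h
  rw [h, degree_neg, degree_mul, degree_X_pow] at h1
  by_contra hw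
  have h0 : ((degreeLTEquiv F k).symm w : F[X]) ≠ 0 := by
    simpa using hw
  rw [degree_eq_natDegree h0] at h1
  have : N + ((degreeLTEquiv F k).symm w : F[X]).natDegree < N := by exact_mod_cast h1
  omega

/-- The message is determined by any `N + k` shares. -/
lemma eq_of_eval_sharePoly_eq {ι : Type*} {x : ι → F} (hx : Function.Injective x) {U : Finset ι}
    (hU : N + k ≤ U.card) {w w' : Fin k → F} {K K' : Fin N → F}
    (h : ∀ l ∈ U, (sharePoly w K).eval (x l) = (sharePoly w' K').eval (x l)) : w = w' := by
  refine sub_eq_zero.1 (eq_zero_of_sharePoly_eq_zero (K := K - K') ?_)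
  refine eq_zero_of_degree_lt_of_eval_index_eq_zero U hx.injOn ?_ ?_
  · exact (degree_sharePoly_lt _ _).trans_le (by exact_mod_cast hU)
  · intro l hl
    rw [← sharePoly_sub, eval_sub, h l hl, sub_self]

/-- A change of the message can be hidden from any `N` shares by a translation of the key. -/
lemma exists_eval_sharePoly_add_eq {ι : Type*} {x : ι → F} (hx : Function.Injective x)
    {A : Finset ι} (hA : A.card ≤ N) (w w' : Fin k → F) :
    ∃ t : Fin N → F, ∀ K : Fin N → F, ∀ l ∈ A,
      (sharePoly w' (K + t)).eval (x l) = (sharePoly w K).eval (x l) := by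
  classical
  -- The change in the message part agrees on the at most `N` points of `A` with a polynomial of
  -- degree below `N`, which is itself a key.
  set p := Lagrange.interpolate A x fun l => (sharePoly (w - w') (0 : Fin N → F)).eval (x l)
  have hp : p ∈ degreeLT F N :=
    mem_degreeLT.2 ((Lagrange.degree_interpolate_lt _ hx.injOn).trans_le (by exact_mod_cast hA))
  refine ⟨degreeLTEquiv F N ⟨p, hp⟩, fun K l hl => ?_⟩
  have h := Lagrange.eval_interpolate_at_node
    (fun l => (sharePoly (w - w') (0 : Fin N → F)).eval (x l)) hx.injOn hl
  have h' : p.eval (x l) = (sharePoly (w - w') (0 : Fin N → F)).eval (x l) := h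
  simp only [sharePoly, map_sub, map_add, map_zero, LinearEquiv.symm_apply_apply,
    Submodule.coe_add, Submodule.coe_sub, Submodule.coe_zero, eval_add, eval_mul, eval_sub,
    eval_zero] at h' ⊢
  rw [h']
  ring

end SecretSharing

/-! ### The sharing code: reliability and secrecy -/

section Achievability

open scoped Classical in
/-- The code that maps the block to a message by `g` and shares the message by polynomials over the
finite field `F`. Its decoder returns a block of `T` that is consistent with the shares. -/
def sharingCode {α : Type*} [Finite α] [MeasurableSpace α] [MeasurableSingletonClass α] {L n : ℕ}
    (N k m : ℕ) {F : Type} [Field F] [Fintype F] [Nonempty α]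
    (x : Fin L → F) (g : (Fin n → α) → Fin k → F) (T : Set (Fin n → α)) :
    SSDCCode α L m n fun _ => Fintype.card F where
  Key := Fin N → F
  keySpace := ⊤
  keyLaw := letI : MeasurableSpace (Fin N → F) := ⊤; uniformOn Set.univ
  isProb :=
    letI : MeasurableSpace (Fin N → F) := ⊤
    isProbabilityMeasure_uniformOn Set.finite_univ Set.univ_nonempty
  enc := fun l ω => Fintype.equivFin F ((sharePoly (g ω.1) ω.2).eval (x l))
  measurable_enc := fun _ =>
    letI : MeasurableSpace (Fin N → F) := ⊤
    haveI : DiscreteMeasurableSpace (Fin N → F) := ⟨fun _ => trivial⟩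
    .of_discrete
  dec := fun U _ y =>
    if h : ∃ s ∈ T, ∃ K : Fin N → F, ∀ l : U,
      Fintype.equivFin F ((sharePoly (g s) K).eval (x l)) = y l then h.choose
    else fun _ => Classical.arbitrary α

namespace sharingCode

variable {α : Type*} [Fintype α] [MeasurableSpace α] [MeasurableSingletonClass α] [Nonempty α]
  {L n N k m : ℕ} {F : Type} [Field F] [Fintype F] {x : Fin L → F} {g : (Fin n → α) → Fin k → F}
  {T : Set (Fin n → α)} (P : Measure α) [IsProbabilityMeasure P]

/-- The decoder's choice may come with another key, but the shares fix the message, and `g` is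
injective on `T`. -/
lemma dec_output (hx : Function.Injective x) (hg : Set.InjOn g T) (hm : N + k ≤ m)
    {U : Finset (Fin L)} (hU : m ≤ U.card)
    {ω : (Fin n → α) × (sharingCode N k m x g T).Key} (hω : ω.1 ∈ T) :
    (sharingCode N k m x g T).dec U hU ((sharingCode N k m x g T).output U ω) = ω.1 := by
  have h : ∃ s ∈ T, ∃ K : Fin N → F, ∀ l : U,
      Fintype.equivFin F ((sharePoly (g s) K).eval (x l)) =
        (sharingCode N k m x g T).output U ω l := ⟨ω.1, hω, ω.2, fun l => rfl⟩
  have hdec : (sharingCode N k m x g T).dec U hU ((sharingCode N k m x g T).output U ω) =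
      h.choose := dif_pos h
  obtain ⟨hT, K, hK⟩ := h.choose_spec
  rw [hdec]
  refine hg hT hω (eq_of_eval_sharePoly_eq hx (hm.trans hU) (K := K) (K' := ω.2) fun l hl => ?_)
  exact (Fintype.equivFin F).injective (hK ⟨l, hl⟩)

lemma measureReal_error_le (hx : Function.Injective x) (hg : Set.InjOn g T) (hm : N + k ≤ m)
    {U : Finset (Fin L)} (hU : m ≤ U.card) :
    ((sharingCode N k m x g T).law P).real {ω | (sharingCode N k m x g T).dec U hU
      ((sharingCode N k m x g T).output U ω) ≠ (sharingCode N k m x g T).source ω} ≤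
      (Measure.pi fun _ : Fin n => P).real Tᶜ := by
  rw [← (sharingCode N k m x g T).measureReal_source_preimage P (Set.toFinite Tᶜ).measurableSet]
  exact measureReal_mono fun ω hω hT => hω (dec_output hx hg hm hU hT)

/-- Translating the key turns the shares of one block into those of another on `A`, and the uniform
law is translation invariant; so the law of these shares does not depend on the block. -/
lemma condShannonEntropy_output (hx : Function.Injective x) {A : Finset (Fin L)}
    (hA : A.card ≤ N) :
    condShannonEntropy ((sharingCode N k m x g T).law P) (sharingCode N k m x g T).source
        ((sharingCode N k m x g T).output A) =
      shannonEntropy ((sharingCode N k m x g T).law P) (sharingCode N k m x g T).source := by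
  set c := sharingCode N k m x g T with hc
  set π := Measure.pi fun _ : Fin n => P with hπ
  have hX : ∀ s, MeasurableSet (c.source ⁻¹' {s}) := fun s =>
    measurable_fst (measurableSet_singleton s)
  have hY : ∀ a, MeasurableSet (c.output A ⁻¹' {a}) := fun a =>
    c.measurable_output A (measurableSet_singleton a)
  let q (s : Fin n → α) (y : (l : A) → Fin (Fintype.card F)) : ℝ :=
    c.keyLaw.real {K | c.output A (s, K) = y}
  have hjoint (s y) : (c.law P).real (c.output A ⁻¹' {y} ∩ c.source ⁻¹' {s}) =
      π.real {s} * q s y := by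
    have : c.output A ⁻¹' {y} ∩ c.source ⁻¹' {s} = {s} ×ˢ {K | c.output A (s, K) = y} := by
      ext ⟨s', K⟩
      constructor
      · rintro ⟨h, rfl⟩
        exact ⟨rfl, h⟩
      · rintro ⟨rfl, h⟩
        exact ⟨h, rfl⟩
    rw [this, SSDCCode.law, measureReal_prod_prod]
  have hq (s s' y) : q s y = q s' y := by
    obtain ⟨t, ht⟩ := exists_eval_sharePoly_add_eq hx hA (g s) (g s')
    let : MeasurableSpace (Fin N → F) := ⊤
    have hpre : {K : Fin N → F | c.output A (s, K) = y} =
        (Equiv.addRight t) ⁻¹' {K : Fin N → F | c.output A (s', K) = y} := by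
      ext K
      have : c.output A (s', K + t) = c.output A (s, K) := by
        funext l
        exact congrArg (Fintype.equivFin F) (ht K l l.2)
      simp [this]
    have hcount (E : Set (Fin N → F)) :
        (uniformOn (Set.univ : Set (Fin N → F))) E = E.encard / Fintype.card (Fin N → F) := by
      rw [uniformOn_univ, Measure.count_apply (show MeasurableSet E from trivial)]
    have hqc (s) : q s y =
      (uniformOn (Set.univ : Set (Fin N → F))).real {K | c.output A (s, K) = y} := rfl
    rw [hqc, hqc, measureReal_def, measureReal_def, hcount, hcount, hpre,
      Set.encard_preimage_of_bijective (Equiv.addRight t).bijective]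
  refine condShannonEntropy_eq_of_measureReal_inter_eq_mul hY fun s y => ?_
  have hmarg : (c.law P).real (c.output A ⁻¹' {y}) = q s y := by
    rw [← sum_measureReal_inter_fiber hX (hY y)]
    calc ∑ s', (c.law P).real (c.source ⁻¹' {s'} ∩ c.output A ⁻¹' {y})
        = ∑ s', (c.law P).real (c.source ⁻¹' {s'}) * q s y := by
          refine Finset.sum_congr rfl fun s' _ => ?_
          rw [Set.inter_comm, hjoint, c.measureReal_source_preimage P (measurableSet_singleton s'),
            hq s' s]
      _ = q s y := by rw [← Finset.sum_mul, sum_measureReal_fiber hX, one_mul]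
  rw [hjoint, hmarg, c.measureReal_source_preimage P (measurableSet_singleton s), mul_comm]

end sharingCode
end Achievability

/-! ### Choice of the field and the symmetric rate tuple -/

section RateRegion

variable {α : Type*} [Fintype α] [MeasurableSpace α] [MeasurableSingletonClass α]
  (P : Measure α) [IsProbabilityMeasure P]

lemma shannonEntropy_nonneg {Ω β : Type*} [MeasurableSpace Ω] [Fintype β] (μ : Measure Ω)
    [IsProbabilityMeasure μ] (X : Ω → β) : 0 ≤ shannonEntropy μ X :=
  Finset.sum_nonneg fun _ _ => Real.negMulLog_nonneg measureReal_nonneg measureReal_le_one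

/-- Bertrand's postulate. The overhead in `log q` does not depend on `t`, so it vanishes after
division by `n`. -/
lemma exists_prime_and_exp_lt (L : ℕ) {t : ℝ} (ht : 0 ≤ t) :
    ∃ q : ℕ, q.Prime ∧ L < q ∧ Real.exp t < q ∧ Real.log q ≤ Real.log (2 * (2 + L)) + t := by
  obtain ⟨q, hq, hlt, hle⟩ := Nat.exists_prime_lt_and_le_two_mul (⌈Real.exp t⌉₊ + L)
    (by have := Nat.ceil_pos.2 (Real.exp_pos t); omega)
  refine ⟨q, hq, by omega, (Nat.le_ceil _).trans_lt (by exact_mod_cast (by omega)), ?_⟩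
  have h1 : (1 : ℝ) ≤ Real.exp t := Real.one_le_exp ht
  have h2 : (q : ℝ) ≤ 2 * (⌈Real.exp t⌉₊ + L) := by exact_mod_cast hle
  have h3 := (Nat.ceil_lt_add_one (Real.exp_pos t).le).le
  have h4 : (q : ℝ) ≤ 2 * (2 + L) * Real.exp t := by
    have : (L : ℝ) ≤ L * Real.exp t := le_mul_of_one_le_right (by positivity) h1
    linarith
  calc Real.log q ≤ Real.log (2 * (2 + L) * Real.exp t) :=
        Real.log_le_log (by exact_mod_cast hq.pos) h4
    _ = _ := by rw [Real.log_mul (by positivity) (Real.exp_pos t).ne', Real.log_exp]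

/-- The symmetric rate tuple `H(S) / (m - N)` is admissible. -/
lemma ssdcAdmissible_const {L N m : ℕ} (hNm : N < m) :
    SSDCAdmissible P L N m
      fun _ => shannonEntropy P (fun s : α => s) / ((m : ℝ) - (N : ℝ)) := by
  obtain ⟨k, hk, rfl⟩ : ∃ k, 0 < k ∧ m = N + k := ⟨m - N, by omega, by omega⟩
  have hkN : ((N + k : ℕ) : ℝ) - N = k := by push_cast; ring
  rw [hkN]
  set H := shannonEntropy P (fun s : α => s) with hH
  have hk' : (0 : ℝ) < k := by exact_mod_cast hk
  have hH0 : 0 ≤ H := shannonEntropy_nonneg P _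
  refine ⟨fun _ => by positivity, fun ε hε => ?_⟩
  have : Nonempty α := nonempty_of_isProbabilityMeasure P
  -- Half of `ε` pays for typicality, spread over `k` symbols; the other half absorbs the constant
  -- `log (2 * (2 + L))`.
  have hδ : 0 < k * (ε / 2) := by positivity
  filter_upwards [eventually_measureReal_compl_typicalSet_le P hδ hε, eventually_gt_atTop 0,
    (tendsto_natCast_atTop_atTop.atTop_mul_const (half_pos hε)).eventually_ge_atTop
      (Real.log (2 * (2 + L)))] with n htyp hn hlog
  have hn' : (0 : ℝ) < n := by exact_mod_cast hn
  obtain ⟨q, hq, hLq, hexp, hlogq⟩ :=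
    exists_prime_and_exp_lt L (t := n * (H / k + ε / 2)) (by positivity)
  have : Fact q.Prime := ⟨hq⟩
  -- The evaluation point 0 is harmless: the key occupies the low coefficients, so that share is a
  -- key symbol when `N > 0`.
  have hx : Function.Injective fun l : Fin L => ((l : ℕ) : ZMod q) := fun l l' h => by
    have h' := congrArg ZMod.val h
    simp only [ZMod.val_natCast_of_lt (l.2.trans hLq),
      ZMod.val_natCast_of_lt (l'.2.trans hLq)] at h'
    exact Fin.ext h'
  obtain ⟨g, -, hg⟩ : ∃ g : (Fin n → α) → Fin k → ZMod q,
      typicalSet P n (k * (ε / 2)) ⊆ g ⁻¹' Set.univ ∧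
        Set.InjOn g (typicalSet P n (k * (ε / 2))) := by
    refine (Set.toFinite _).exists_injOn_of_encard_le ?_
    rw [← (Set.toFinite (typicalSet P n (k * (ε / 2)))).cast_ncard_eq,
      ← (Set.toFinite (Set.univ : Set (Fin k → ZMod q))).cast_ncard_eq, Set.ncard_univ,
      Nat.card_eq_fintype_card, Fintype.card_fun, ZMod.card, Fintype.card_fin]
    have h : ((typicalSet P n (k * (ε / 2))).ncard : ℝ) ≤ (q : ℝ) ^ k := by
      refine (card_typicalSet_le P n _).trans ?_
      calc Real.exp (n * (H + k * (ε / 2))) = Real.exp (n * (H / k + ε / 2)) ^ k := by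
            rw [← Real.exp_nat_mul]
            congr 1
            field_simp
        _ ≤ (q : ℝ) ^ k := by gcongr
    exact_mod_cast h
  refine ⟨_, sharingCode N k (N + k) (fun l : Fin L => ((l : ℕ) : ZMod q)) g
    (typicalSet P n (k * (ε / 2))), fun _ => ?_, fun U hU => ?_, fun A hA => ?_⟩
  · rw [ZMod.card, one_div, inv_mul_le_iff₀ hn']
    linarith
  · exact (sharingCode.measureReal_error_le P hx hg le_rfl hU).trans htyp
  · exact sharingCode.condShannonEntropy_output P hx hA

end RateRegion

end

/-- The minimum sum rate of the `(L, N, m)` problem exists and equals `L / (m - N) * H(S)`. -/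
theorem corollary1 {α : Type*} [Fintype α] [MeasurableSpace α] [MeasurableSingletonClass α]
    (P : Measure α) [IsProbabilityMeasure P] (L N m : ℕ) (hNm : N < m) (hmL : m ≤ L) :
    IsLeast ((fun R : Fin L → ℝ => ∑ l, R l) '' ssdcRegion P L N m)
      ((L : ℝ) / ((m : ℝ) - (N : ℝ)) * shannonEntropy P (fun s : α => s)) := by
  refine ⟨⟨_, ssdcAdmissible_const P hNm, ?_⟩, ?_⟩
  · simp only [Finset.sum_const, Finset.card_univ, Fintype.card_fin, nsmul_eq_mul]
    ring
  · rintro _ ⟨R, hR, rfl⟩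
    rw [← Nat.cast_sub hNm.le]
    exact div_mul_le_sum_of_forall_card (by omega) (by omega)
      fun B hB => SSDCAdmissible.shannonEntropy_le_sum hR hNm hmL hB
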